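/- Let $n\ge 1$ and let $\mathcal B$ be the collection of all open cubes in $\mathbb R^n$ with sides parallel to the coordinate axes. For $f:\mathbb R^n\to\mathbb R$ let $$M_{\mathrm{HL},c}f(x)=\sup_{x\in R\in\mathcal B}\frac1{|R|}\int_R|f|$$ be the uncentered Hardy–Littlewood maximal operator with respect to cubes, where $|\cdot|$ is Lebesgue measure, and let $\phi_{\mathrm{HL},c}$ be its halo function, that is, $\phi_{\mathrm{HL},c}(\alpha)=\alpha$ for $0\le\alpha\le1$ and $$\phi_{\mathrm{HL},c}(\alpha)=\sup_{E}\frac{1}{|E|}\,\bigl|\{x\in\mathbb R^n: M_{\mathrm{HL},c}\chi_E(x)>1/\alpha\}\bigr|\qquad(\alpha>1),$$ the supremum being over all Lebesgue measurable $E\subset\mathbb R^n$ with $0<|E|<\infty$. Then $\phi_{\mathrm{HL},c}$ is finite on $[0,\infty)$ and $\phi_{\mathrm{HL},c}\in C^{1/n}([0,\infty))$: for every compact set $K\subset[0,\infty)$ there is a constant $C$ such that $$|\phi_{\mathrm{HL},c}(x)-\phi_{\mathrm{HL},c}(y)|\le C\,|x-y|^{1/n}\qquad\text{for all }x,y\in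 K.$$ -/

import Mathlib

open MeasureTheory
open scoped ENNReal NNReal

namespace GeomMax

/-- The basis of all (nondegenerate, open) cubes in `ℝⁿ` with sides parallel to the coordinate
axes. Here `ℝⁿ` is `Fin n → ℝ`, whose `volume` is Lebesgue measure. -/
def cubes (n : ℕ) : Set (Set (Fin n → ℝ)) :=
  {R | ∃ (a : Fin n → ℝ) (l : ℝ), 0 < l ∧ R = Set.pi Set.univ (fun i => Set.Ioo (a i) (a i + l))}

/-- The (uncentered) maximal operator of a basis `B`: the supremum of the averages of `|f|` over
all `R ∈ B` containing `x`; it is `0` when no member of `B` contains `x`. -/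
noncomputable def maximalFunction {n : ℕ} (B : Set (Set (Fin n → ℝ))) (f : (Fin n → ℝ) → ℝ)
    (x : Fin n → ℝ) : ℝ≥0∞ :=
  ⨆ R ∈ {R ∈ B | x ∈ R}, (∫⁻ y in R, ‖f y‖ₑ) / volume R

/-- The halo set `{x : M_B χ_E (x) > t}`. -/
def haloSet {n : ℕ} (B : Set (Set (Fin n → ℝ))) (t : ℝ) (E : Set (Fin n → ℝ)) :
    Set (Fin n → ℝ) :=
  {x | ENNReal.ofReal t < maximalFunction B (E.indicator (fun _ => (1 : ℝ))) x}

/-- The halo function of a basis `B`, with values in `[0, ∞]`: for `1 < a` it is the supremum of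
`|{M_B χ_E > 1 / a}| / |E|` over all Lebesgue measurable `E` with `0 < |E| < ∞`, and it is `a`
for `0 ≤ a ≤ 1`. (Only arguments `0 ≤ a` are meaningful.) -/
noncomputable def haloFunction {n : ℕ} (B : Set (Set (Fin n → ℝ))) (a : ℝ) : ℝ≥0∞ :=
  if a ≤ 1 then ENNReal.ofReal a
  else ⨆ E ∈ {E : Set (Fin n → ℝ) | NullMeasurableSet E volume ∧ 0 < volume E ∧ volume E < ∞},
    volume (haloSet B (1 / a) E) / volume E

/-- The (local) Hölder class `C^p(I)`: for every compact `K ⊆ I` there is a constant `C` with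
`|f x - f y| ≤ C * |x - y| ^ p` for all `x, y ∈ K`. -/
def HolderClass (p : ℝ≥0) (I : Set ℝ) (f : ℝ → ℝ) : Prop :=
  ∀ K : Set ℝ, IsCompact K → K ⊆ I → ∃ C : ℝ≥0, HolderOnWith C p f K

end GeomMax

/-!
Two facts about a set `E` of finite measure drive the proof.

* A Solyanik estimate: for `s ≤ 1` there is `E'` with `|E'| ≤ (1 + s)ⁿ |E|` containing every cube
  of which `E` leaves out a proportion less than `(s / 4)ⁿ`. In dimension one, finitely many
  intervals can be thinned out so that every point lies in at most two of them; products are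
  handled with Markov's inequality.
* Density gain: if `E` leaves out at least that proportion of a cube `Q`, then by contracting `Q`
  towards the density points of `E` in `Q`, almost all of `Q ∩ E` is covered by subcubes of which
  `E` leaves out exactly the proportion `(s / 4)ⁿ / 2`. They all lie in `E'`, so by the Vitali
  covering lemma the density of `E'` in `Q` exceeds that of `E` by a factor of at least
  `1 + (s / 16)ⁿ / 2`.

Hence a cube in which `E` has density greater than `1 / ((1 + (s / 16)ⁿ / 2) a)` either lies in `E'`
or has density greater than `1 / a` in `E'`. This gives the inequality
`φ((1 + (s / 16)ⁿ / 2) a) ≤ (1 + s)ⁿ φ(a)` for `a ≥ 1`, in which an increment of order `sⁿ` of the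
argument costs an increment of order `s` of `φ`.
-/

universe u

namespace GeomMax

open Set Filter Topology
open Metric (closedBall ball)

section Intervals

lemma exists_subset_biUnion_eq_irredundant {ι α : Type*} [DecidableEq ι] (f : ι → Set α)
    (s : Finset ι) :
    ∃ t ⊆ s, ⋃ i ∈ t, f i = ⋃ i ∈ s, f i ∧ ∀ i ∈ t, ¬ f i ⊆ ⋃ j ∈ t.erase i, f j := by
  induction s using Finset.strongInduction with
  | H s ih =>
  by_cases! h : ∃ i ∈ s, f i ⊆ ⋃ j ∈ s.erase i, f j
  · obtain ⟨i, hi, hsub⟩ := h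
    obtain ⟨t, hts, hU, ht⟩ := ih _ (Finset.erase_ssubset hi)
    refine ⟨t, hts.trans (s.erase_subset i), hU.trans ?_, ht⟩
    rw [← Finset.insert_erase hi, Finset.set_biUnion_insert, Finset.insert_erase hi,
      union_eq_self_of_subset_left hsub]
  · exact ⟨s, subset_rfl, rfl, h⟩

/-- Among the intervals containing a point, the one with the smallest left endpoint and the one
with the largest right endpoint cover all the others. -/
lemma card_filter_mem_Ioo_le_two {α : Type*} [LinearOrder α] {t : Finset (α × α)}
    (ht : ∀ p ∈ t, ¬ Ioo p.1 p.2 ⊆ ⋃ q ∈ t.erase p, Ioo q.1 q.2) (x : α) :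
    (t.filter fun p => x ∈ Ioo p.1 p.2).card ≤ 2 := by
  by_contra! hcard
  set F := t.filter fun p => x ∈ Ioo p.1 p.2 with hF
  have hne : F.Nonempty := Finset.card_pos.1 (by lia)
  obtain ⟨p, hp, hp_min⟩ := F.exists_min_image Prod.fst hne
  obtain ⟨q, hq, hq_max⟩ := F.exists_max_image Prod.snd hne
  obtain ⟨r, hr, hr_notMem⟩ : ∃ r ∈ F, r ∉ ({p, q} : Finset (α × α)) :=
    Finset.exists_mem_notMem_of_card_lt_card (Finset.card_le_two.trans_lt hcard)
  simp only [Finset.mem_insert, Finset.mem_singleton, not_or] at hr_notMem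
  have hpr := hp_min r hr
  have hrq := hq_max r hr
  rw [hF, Finset.mem_filter] at hp hq hr
  refine ht r hr.1 fun y hy => ?_
  rcases le_or_gt y x with hyx | hxy
  · exact mem_biUnion (Finset.mem_coe.2 (Finset.mem_erase.2 ⟨Ne.symm hr_notMem.1, hp.1⟩))
      ⟨hpr.trans_lt hy.1, hyx.trans_lt hp.2.2⟩
  · exact mem_biUnion (Finset.mem_coe.2 (Finset.mem_erase.2 ⟨Ne.symm hr_notMem.2, hq.1⟩))
      ⟨hq.2.1.trans hxy, hy.2.trans_le hrq⟩

lemma sum_measure_le_mul_measure_biUnion {ι X : Type*} [MeasurableSpace X] (μ : Measure X)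
    {f : ι → Set X} [∀ x, DecidablePred fun i => x ∈ f i] {t : Finset ι}
    (hf : ∀ i ∈ t, MeasurableSet (f i)) {k : ℕ} (hk : ∀ x, (t.filter fun i => x ∈ f i).card ≤ k) :
    ∑ i ∈ t, μ (f i) ≤ k * μ (⋃ i ∈ t, f i) := by
  have hU : MeasurableSet (⋃ i ∈ t, f i) := Finset.measurableSet_biUnion _ hf
  calc ∑ i ∈ t, μ (f i)
      = ∫⁻ x, ∑ i ∈ t, (f i).indicator 1 x ∂μ := by
        rw [lintegral_finsetSum' _ fun i hi => (measurable_one.indicator (hf i hi)).aemeasurable]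
        exact Finset.sum_congr rfl fun i hi => (lintegral_indicator_one (hf i hi)).symm
    _ ≤ ∫⁻ x, k * (⋃ i ∈ t, f i).indicator 1 x ∂μ := by
        refine lintegral_mono fun x => ?_
        have hsum : ∑ i ∈ t, (f i).indicator 1 x = ((t.filter fun i => x ∈ f i).card : ℝ≥0∞) := by
          simp only [indicator_apply, Pi.one_apply, Finset.sum_boole]
        rw [hsum]
        by_cases hx : x ∈ ⋃ i ∈ t, f i
        · rw [indicator_of_mem hx, Pi.one_apply, mul_one]
          exact Nat.cast_le.2 (hk x)
        · rw [Finset.filter_false_of_mem fun i hi hxi => hx (mem_biUnion hi hxi)]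
          simp
    _ = k * μ (⋃ i ∈ t, f i) := by
        rw [lintegral_const_mul _ (measurable_one.indicator hU), lintegral_indicator_one hU]

variable (μ : Measure ℝ) [IsLocallyFiniteMeasure μ]

lemma measure_biUnion_finset_Ioo_le {s : ℝ≥0} (hs : s ≤ 1) (A : Set ℝ) (F : Finset (ℝ × ℝ))
    (hF : ∀ p ∈ F, μ (Ioo p.1 p.2 \ A) ≤ ↑(s / 4) * μ (Ioo p.1 p.2)) :
    μ (⋃ p ∈ F, Ioo p.1 p.2) ≤ (1 + s) * μ A := by
  obtain ⟨t, htF, hU, ht⟩ := exists_subset_biUnion_eq_irredundant (fun p : ℝ × ℝ => Ioo p.1 p.2) F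
  rw [← hU]
  set U := ⋃ p ∈ t, Ioo p.1 p.2 with hUdef
  have hU_top : μ U ≠ ∞ :=
    (measure_biUnion_lt_top t.finite_toSet fun p _ => measure_Ioo_lt_top).ne
  have hUA : μ (U \ A) ≤ ↑(s / 2) * μ U :=
    calc μ (U \ A) = μ (⋃ p ∈ t, Ioo p.1 p.2 \ A) := by simp only [hUdef, iUnion_sdiff]
      _ ≤ ∑ p ∈ t, μ (Ioo p.1 p.2 \ A) := measure_biUnion_finset_le t _
      _ ≤ ∑ p ∈ t, ↑(s / 4) * μ (Ioo p.1 p.2) := Finset.sum_le_sum fun p hp => hF p (htF hp)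
      _ ≤ ↑(s / 4) * (2 * μ U) := by
        rw [← Finset.mul_sum]
        gcongr
        exact sum_measure_le_mul_measure_biUnion μ (fun _ _ => measurableSet_Ioo)
          (card_filter_mem_Ioo_le_two ht)
      _ = ↑(s / 2) * μ U := by
        rw [← mul_assoc]
        norm_cast
        congr 2
        ring
  rcases eq_or_ne (μ A) ∞ with hA | hA
  · simp [hA]
  have hU_le : μ U ≤ μ A + ↑(s / 2) * μ U :=
    (measure_le_inter_add_sdiff μ U A).trans (add_le_add (measure_mono inter_subset_right) hUA)
  lift μ U to ℝ≥0 using hU_top with u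
  lift μ A to ℝ≥0 using hA with a
  norm_cast at hU_le ⊢
  rw [← NNReal.coe_le_coe] at hU_le hs ⊢
  push_cast at hU_le hs ⊢
  have h_inv : 1 ≤ (1 + (s : ℝ)) * (1 - s / 2) := by nlinarith [s.2]
  calc (u : ℝ) ≤ (1 + s) * (1 - s / 2) * u := le_mul_of_one_le_left u.2 h_inv
    _ = (1 + s) * (u - s / 2 * u) := by ring
    _ ≤ (1 + s) * a := by gcongr; linarith

lemma measure_iUnion_Ioo_le {ι : Type*} [Countable ι] {s : ℝ≥0} (hs : s ≤ 1) (A : Set ℝ)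
    (a b : ι → ℝ) (h : ∀ i, μ (Ioo (a i) (b i) \ A) ≤ ↑(s / 4) * μ (Ioo (a i) (b i))) :
    μ (⋃ i, Ioo (a i) (b i)) ≤ (1 + s) * μ A := by
  classical
  rw [iUnion_eq_iUnion_finset, Directed.measure_iUnion]
  · refine iSup_le fun F => ?_
    have := measure_biUnion_finset_Ioo_le μ hs A (F.image fun i => (a i, b i)) fun p hp => by
      obtain ⟨i, -, rfl⟩ := Finset.mem_image.1 hp
      exact h i
    rwa [Finset.set_biUnion_finset_image] at this
  · exact Monotone.directed_le fun F G hFG => biUnion_subset_biUnion_left hFG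

lemma exists_rat_Ioo_measure_sdiff_lt {a b : ℝ} (hab : a ≤ b) {A : Set ℝ} {c : ℝ≥0∞}
    (h : μ (Icc a b \ A) < c) :
    ∃ p q : ℚ, Icc a b ⊆ Ioo (p : ℝ) q ∧ μ (Ioo (p : ℝ) q \ A) < c := by
  rw [sdiff_eq, ← Measure.restrict_apply measurableSet_Icc] at h
  obtain ⟨U, hIU, hU, hUc⟩ := (Icc a b).exists_isOpen_lt_of_lt c h
  obtain ⟨l, hla, hlU⟩ := exists_Ioc_subset_of_mem_nhds
    (hU.mem_nhds (hIU (left_mem_Icc.2 hab))) (exists_lt a)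
  obtain ⟨r, hbr, hrU⟩ := exists_Ico_subset_of_mem_nhds
    (hU.mem_nhds (hIU (right_mem_Icc.2 hab))) (exists_gt b)
  obtain ⟨p, hlp, hpa⟩ := exists_rat_btwn hla
  obtain ⟨q, hbq, hqr⟩ := exists_rat_btwn hbr
  refine ⟨p, q, Icc_subset_Ioo hpa hbq, ?_⟩
  have hsub : Ioo (p : ℝ) q ⊆ U := fun y hy => by
    rcases le_total y a with hya | hay
    · exact hlU ⟨hlp.trans hy.1, hya⟩
    rcases le_total y b with hyb | hby
    · exact hIU ⟨hay, hyb⟩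
    · exact hrU ⟨hby, hy.2.trans hqr⟩
  rw [sdiff_eq, ← Measure.restrict_apply measurableSet_Ioo]
  exact (measure_mono hsub).trans_lt hUc

end Intervals

section Solyanik

/-- The closed order intervals of `α`; in `Fin n → ℝ` these are the closed boxes with sides
parallel to the axes. -/
def closedBoxes (α : Type*) [Preorder α] : Set (Set α) :=
  {R | ∃ a b, R = Icc a b}

/-- A Solyanik estimate, uniform in a parameter, for a family `𝓡` of sets: for every measurable `E`
there is a set `E'`, of measure at most `c` times that of `E`, which contains each member of `𝓡` of
which `E` leaves out a proportion less than `δ`. The set `E'` is jointly measurable in the point and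
in a parameter `p : P`; this is what makes the estimate stable under products. -/
def FiberwiseSolyanik {X : Type u} [MeasurableSpace X] (μ : Measure X) (𝓡 : Set (Set X))
    (c δ : ℝ≥0∞) : Prop :=
  ∀ ⦃P : Type u⦄ [MeasurableSpace P] ⦃E : Set (P × X)⦄, MeasurableSet E →
    ∃ E' : Set (P × X), MeasurableSet E' ∧
      (∀ p, μ (Prod.mk p ⁻¹' E') ≤ c * μ (Prod.mk p ⁻¹' E)) ∧
      ∀ p, ∀ R ∈ 𝓡, μ (R \ Prod.mk p ⁻¹' E) < δ * μ R → R ⊆ Prod.mk p ⁻¹' E'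

theorem fiberwiseSolyanik_real (μ : Measure ℝ) [IsLocallyFiniteMeasure μ] {s : ℝ≥0} (hs : s ≤ 1) :
    FiberwiseSolyanik μ (closedBoxes ℝ) (1 + s) ↑(s / 4) := by
  intro P _ E hE
  -- Rational endpoints keep the union of the admissible intervals countable, hence measurable.
  let I (r : ℚ × ℚ) : Set ℝ := Ioo (r.1 : ℝ) r.2
  let T (r : ℚ × ℚ) : Set P := {p | μ (I r \ Prod.mk p ⁻¹' E) < ↑(s / 4) * μ (I r)}
  refine ⟨⋃ r, T r ×ˢ I r, ?_, fun p => ?_, ?_⟩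
  · refine MeasurableSet.iUnion fun r => MeasurableSet.prod ?_ measurableSet_Ioo
    have hdiff : MeasurableSet ((Prod.snd ⁻¹' I r) \ E : Set (P × ℝ)) :=
      (measurable_snd measurableSet_Ioo).diff hE
    exact measurableSet_lt (measurable_measure_prodMk_left hdiff) measurable_const
  · have hfib : Prod.mk p ⁻¹' ⋃ r, T r ×ˢ I r = ⋃ r : {r // p ∈ T r}, I r := by
      ext t
      simp only [mem_preimage, mem_iUnion, mem_prod, Subtype.exists, exists_prop]
    rw [hfib]
    exact measure_iUnion_Ioo_le μ hs _ _ _ fun r => r.2.le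
  · rintro p _ ⟨a, b, rfl⟩ h t ht
    obtain ⟨l, r, hsub, hlt⟩ := exists_rat_Ioo_measure_sdiff_lt μ (ht.1.trans ht.2) h
    exact mem_iUnion.2 ⟨(l, r), hlt.trans_le (by gcongr), hsub ht⟩

namespace FiberwiseSolyanik

variable {X Y : Type u} [MeasurableSpace X] [MeasurableSpace Y] {μ : Measure X} {ν : Measure Y}
  {𝓡 : Set (Set X)} {𝓢 : Set (Set Y)} {c c' δ δ' : ℝ≥0∞}

lemma of_subsingleton [Subsingleton X] : FiberwiseSolyanik μ 𝓡 1 1 := by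
  refine fun P _ E hE => ⟨E, hE, fun p => (one_mul _).ge, fun p R _ h x _ => ?_⟩
  by_contra hxE
  have hdisj : R \ Prod.mk p ⁻¹' E = R :=
    sdiff_eq_left.2 (disjoint_left.2 fun y _ hy => hxE (Subsingleton.elim y x ▸ hy))
  simp [hdisj] at h

lemma comap (h : FiberwiseSolyanik ν 𝓢 c δ) (e : X ≃ᵐ Y) (he : MeasurePreserving e μ ν)
    (h𝓡 : ∀ R ∈ 𝓡, e.symm ⁻¹' R ∈ 𝓢) : FiberwiseSolyanik μ 𝓡 c δ := by
  intro P _ E hE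
  have hpre (A : Set X) : ν (e.symm ⁻¹' A) = μ A := he.symm.measure_preimage_equiv A
  obtain ⟨E', hE', hvol, hsub⟩ :=
    h (P := P) (E := Prod.map id e.symm ⁻¹' E) ((measurable_id.prodMap e.symm.measurable) hE)
  refine ⟨Prod.map id e ⁻¹' E', (measurable_id.prodMap e.measurable) hE', fun p => ?_,
    fun p R hR hlt x hx => ?_⟩
  · calc μ (e ⁻¹' (Prod.mk p ⁻¹' E')) = ν (Prod.mk p ⁻¹' E') := he.measure_preimage_equiv _
      _ ≤ c * ν (e.symm ⁻¹' (Prod.mk p ⁻¹' E)) := hvol p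
      _ = c * μ (Prod.mk p ⁻¹' E) := by rw [hpre]
  · have hlt' : ν (e.symm ⁻¹' (R \ Prod.mk p ⁻¹' E)) < δ * ν (e.symm ⁻¹' R) := by rwa [hpre, hpre]
    exact hsub p _ (h𝓡 R hR) hlt' (by simpa using hx)

section Prod

lemma prod_apply_le_mul_of_forall_fst [SFinite ν] {A B : Set (X × Y)} (hA : MeasurableSet A)
    (hB : MeasurableSet B) (h : ∀ x, ν (Prod.mk x ⁻¹' B) ≤ c * ν (Prod.mk x ⁻¹' A)) :
    μ.prod ν B ≤ c * μ.prod ν A := by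
  rw [Measure.prod_apply hA, Measure.prod_apply hB,
    ← lintegral_const_mul _ (measurable_measure_prodMk_left hA)]
  exact lintegral_mono h

lemma prod_apply_le_mul_of_forall_snd [SFinite μ] [SFinite ν] {A B : Set (X × Y)}
    (hA : MeasurableSet A) (hB : MeasurableSet B)
    (h : ∀ y, μ ((·, y) ⁻¹' B) ≤ c * μ ((·, y) ⁻¹' A)) :
    μ.prod ν B ≤ c * μ.prod ν A := by
  rw [Measure.prod_apply_symm hA, Measure.prod_apply_symm hB,
    ← lintegral_const_mul _ (measurable_measure_prodMk_right hA)]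
  exact lintegral_mono h

lemma measure_section_ge_lt_of_prod_sdiff_lt [SFinite μ] [SFinite ν] {A : Set (X × Y)}
    (hA : MeasurableSet A) {R : Set X} {S : Set Y}
    (h : μ.prod ν (R ×ˢ S \ A) < δ * δ' * μ.prod ν (R ×ˢ S)) :
    ν ({y | δ * μ R ≤ μ (R \ (·, y) ⁻¹' A)} ∩ S) < δ' * ν S := by
  have hsec (y : Y) : μ (R \ (·, y) ⁻¹' A) = μ.restrict R ((·, y) ⁻¹' Aᶜ) := by
    rw [Measure.restrict_apply (measurable_prodMk_right hA.compl), preimage_compl, inter_comm,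
      ← Set.sdiff_eq]
  refine lt_of_mul_lt_mul_left' (a := δ * μ R) ?_
  calc δ * μ R * ν ({y | δ * μ R ≤ μ (R \ (·, y) ⁻¹' A)} ∩ S)
      ≤ δ * μ R * ν.restrict S {y | δ * μ R ≤ μ.restrict R ((·, y) ⁻¹' Aᶜ)} := by
        simp only [hsec]
        exact mul_le_mul_right (Measure.le_restrict_apply _ _) _
    _ ≤ ∫⁻ y, μ.restrict R ((·, y) ⁻¹' Aᶜ) ∂ν.restrict S :=
        mul_meas_ge_le_lintegral (measurable_measure_prodMk_right hA.compl) _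
    _ = μ.prod ν (R ×ˢ S \ A) := by
        rw [← Measure.prod_apply_symm hA.compl, Measure.prod_restrict,
          Measure.restrict_apply hA.compl, inter_comm, ← Set.sdiff_eq]
    _ < δ * δ' * μ.prod ν (R ×ˢ S) := h
    _ = δ * μ R * (δ' * ν S) := by
        rw [Measure.prod_prod]
        ring

/-- Apply the estimate to the sections along `X` first, with the `Y`-coordinate as an extra
parameter, and then to those along `Y`. By Markov's inequality, a product set almost filled by `E`
has almost all its sections along `X` almost filled by `E`. -/
theorem prod [SFinite μ] [SFinite ν] (hμ : FiberwiseSolyanik μ 𝓡 c δ)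
    (hν : FiberwiseSolyanik ν 𝓢 c' δ') :
    FiberwiseSolyanik (μ.prod ν) (image2 (· ×ˢ ·) 𝓡 𝓢) (c' * c) (δ * δ') := by
  intro P _ E hE
  obtain ⟨F, hF, hF_vol, hF_sub⟩ := hμ (P := P × Y) (E := {z | (z.1.1, z.2, z.1.2) ∈ E})
    ((by fun_prop : Measurable fun z : (P × Y) × X => (z.1.1, z.2, z.1.2)) hE)
  obtain ⟨G, hG, hG_vol, hG_sub⟩ := hν (P := P × X) (E := {z | ((z.1.1, z.2), z.1.2) ∈ F})
    ((by fun_prop : Measurable fun z : (P × X) × Y => ((z.1.1, z.2), z.1.2)) hF)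
  have hE_sec (p : P) : MeasurableSet (Prod.mk p ⁻¹' E) := measurable_prodMk_left hE
  have hF_sec (p : P) : MeasurableSet {z : X × Y | ((p, z.2), z.1) ∈ F} :=
    (by fun_prop : Measurable fun z : X × Y => ((p, z.2), z.1)) hF
  have hG_sec (p : P) : MeasurableSet {z : X × Y | ((p, z.1), z.2) ∈ G} :=
    (by fun_prop : Measurable fun z : X × Y => ((p, z.1), z.2)) hG
  refine ⟨{z | ((z.1, z.2.1), z.2.2) ∈ G},
    (by fun_prop : Measurable fun z : P × X × Y => ((z.1, z.2.1), z.2.2)) hG, fun p => ?_, ?_⟩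
  · calc μ.prod ν {z | ((p, z.1), z.2) ∈ G}
        ≤ c' * μ.prod ν {z | ((p, z.2), z.1) ∈ F} :=
          prod_apply_le_mul_of_forall_fst (hF_sec p) (hG_sec p) fun x => hG_vol (p, x)
      _ ≤ c' * (c * μ.prod ν (Prod.mk p ⁻¹' E)) := by
          gcongr
          exact prod_apply_le_mul_of_forall_snd (hE_sec p) (hF_sec p) fun y => hF_vol (p, y)
      _ = c' * c * μ.prod ν (Prod.mk p ⁻¹' E) := (mul_assoc _ _ _).symm
  · rintro p _ ⟨R, hR, S, hS, rfl⟩ h ⟨x, y⟩ ⟨hx, hy⟩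
    refine hG_sub (p, x) S hS (lt_of_le_of_lt (measure_mono ?_)
      (measure_section_ge_lt_of_prod_sdiff_lt (hE_sec p) h)) hy
    rintro y' ⟨hy'S, hy'F⟩
    refine ⟨?_, hy'S⟩
    by_contra hlt
    exact hy'F (hF_sub (p, y') R hR (not_le.1 hlt) hx)

end Prod

theorem volume_pi {s : ℝ≥0} (hs : s ≤ 1) (n : ℕ) :
    FiberwiseSolyanik (volume : Measure (Fin n → ℝ)) (closedBoxes (Fin n → ℝ))
      ((1 + s) ^ n) (↑(s / 4) ^ n) := by
  induction n with
  | zero => simpa only [pow_zero] using of_subsingleton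
  | succ n ih =>
    have hprod := (fiberwiseSolyanik_real volume hs).prod ih
    rw [← pow_succ, ← pow_succ'] at hprod
    refine hprod.comap (MeasurableEquiv.piFinSuccAbove (fun _ => ℝ) 0)
      (volume_preserving_piFinSuccAbove (fun _ => ℝ) 0) ?_
    rintro _ ⟨a, b, rfl⟩
    refine ⟨Icc (a 0) (b 0), ⟨_, _, rfl⟩, Icc (Fin.tail a) (Fin.tail b), ⟨_, _, rfl⟩, ?_⟩
    ext ⟨x, y⟩
    simp [Pi.le_def, Fin.forall_fin_succ, Fin.tail, and_and_and_comm,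
      MeasurableEquiv.piFinSuccAbove]

lemma exists_superset (h : FiberwiseSolyanik μ 𝓡 c δ) {E : Set X} (hE : MeasurableSet E) :
    ∃ E', MeasurableSet E' ∧ μ E' ≤ c * μ E ∧ ∀ R ∈ 𝓡, μ (R \ E) < δ * μ R → R ⊆ E' := by
  obtain ⟨E', hE', hvol, hsub⟩ := h (P := PUnit) (measurable_snd hE)
  exact ⟨Prod.mk PUnit.unit ⁻¹' E', measurable_prodMk_left hE', hvol _, hsub _⟩

end FiberwiseSolyanik

end Solyanik

section DensityGain

open Module (finrank)

section Sdiff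

variable {X : Type*} [MeasurableSpace X] {μ : Measure X}

lemma dist_measureReal_sdiff_le {A B : Set X} (hAB : A ⊆ B) (hA : MeasurableSet A) (hB : μ B ≠ ∞)
    (E : Set X) : dist (μ.real (A \ E)) (μ.real (B \ E)) ≤ dist (μ.real A) (μ.real B) := by
  have hB_top {S : Set X} (hS : S ⊆ B) : μ S ≠ ∞ := measure_ne_top_of_subset hS hB
  have hsub : B \ E ⊆ (A \ E) ∪ (B \ A) := fun x hx =>
    (em (x ∈ A)).imp (fun h => ⟨h, hx.2⟩) fun h => ⟨hx.1, h⟩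
  have hle : μ.real (B \ E) ≤ μ.real (A \ E) + (μ.real B - μ.real A) := by
    rw [← measureReal_sdiff hAB hA hB]
    exact (measureReal_mono hsub (measure_union_ne_top (hB_top (sdiff_subset.trans hAB))
      (hB_top sdiff_subset))).trans (measureReal_union_le _ _)
  have hmono : μ.real (A \ E) ≤ μ.real (B \ E) :=
    measureReal_mono (sdiff_subset_sdiff_left hAB) (hB_top sdiff_subset)
  rw [dist_comm, dist_comm (μ.real A), Real.dist_eq, Real.dist_eq, abs_of_nonneg (by linarith),
    abs_of_nonneg (sub_nonneg.2 (measureReal_mono hAB))]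
  linarith

lemma continuousOn_measureReal_sdiff {ι : Type*} [LinearOrder ι] [TopologicalSpace ι]
    {Q : ι → Set X} {I : Set ι} (hQ : MonotoneOn Q I) (hQ_meas : ∀ i, MeasurableSet (Q i))
    (hQ_top : ∀ i, μ (Q i) ≠ ∞) (hcont : ContinuousOn (fun i => μ.real (Q i)) I) (E : Set X) :
    ContinuousOn (fun i => μ.real (Q i \ E)) I := by
  intro i hi
  refine tendsto_iff_dist_tendsto_zero.2 (squeeze_zero' (.of_forall fun _ => dist_nonneg) ?_
    (tendsto_iff_dist_tendsto_zero.1 (hcont i hi)))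
  filter_upwards [self_mem_nhdsWithin] with j hj
  rcases le_total i j with hij | hji
  · rw [dist_comm, dist_comm (μ.real (Q j))]
    exact dist_measureReal_sdiff_le (hQ hi hj hij) (hQ_meas i) (hQ_top j) E
  · exact dist_measureReal_sdiff_le (hQ hj hi hji) (hQ_meas j) (hQ_top i) E

end Sdiff

variable {V : Type*} [NormedAddCommGroup V] [NormedSpace ℝ V]

/-- The image of `closedBall w r` under the homothety with centre `x` and ratio `s`. -/
def contractedBall (x w : V) (r s : ℝ) : Set V :=
  closedBall (AffineMap.lineMap x w s) (s * r)

variable {x w : V} {r : ℝ}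

lemma contractedBall_one (x w : V) (r : ℝ) : contractedBall x w r 1 = closedBall w r := by
  simp [contractedBall]

lemma mem_contractedBall (hx : x ∈ closedBall w r) {s : ℝ} (hs : 0 ≤ s) :
    x ∈ contractedBall x w r s := by
  rw [contractedBall, Metric.mem_closedBall, dist_left_lineMap, Real.norm_of_nonneg hs]
  exact mul_le_mul_of_nonneg_left hx hs

lemma monotone_contractedBall (hx : x ∈ closedBall w r) : Monotone (contractedBall x w r) := by
  intro s s' hss'
  refine Metric.closedBall_subset_closedBall' ?_
  rw [dist_lineMap_lineMap, Real.dist_eq, abs_of_nonpos (sub_nonpos.2 hss')]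
  linarith [mul_le_mul_of_nonneg_left (Metric.mem_closedBall.1 hx) (sub_nonneg.2 hss')]

variable [FiniteDimensional ℝ V] [MeasurableSpace V] [BorelSpace V] {μ : Measure V}
  [μ.IsAddHaarMeasure]

lemma continuousOn_measureReal_contractedBall (hr : 0 ≤ r) :
    ContinuousOn (fun s => μ.real (contractedBall x w r s)) (Ici 0) := by
  have hcont : ContinuousOn (fun s : ℝ => (s * r) ^ finrank ℝ V * μ.real (closedBall (0 : V) 1))
      (Ici 0) := by fun_prop
  exact hcont.congr fun s hs =>
    Measure.addHaar_real_closedBall' μ _ (mul_nonneg hs hr)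

lemma ae_eventually_measure_contractedBall_sdiff_lt (μ : Measure V) [μ.IsAddHaarMeasure]
    {E : Set V} (hE : MeasurableSet E) {δ : ℝ≥0∞} (hδ : 0 < δ) (w : V) (hr : 0 < r) :
    ∀ᵐ x ∂μ, x ∈ closedBall w r → x ∈ E → ∀ᶠ s in 𝓝[>] (0 : ℝ),
      μ (contractedBall x w r s \ E) < δ * μ (contractedBall x w r s) := by
  filter_upwards [(IsUnifLocDoublingMeasure.vitaliFamily μ 1
    ).ae_tendsto_measure_inter_div_of_measurableSet hE.compl] with x hx hxw hxE
  have hradius : Tendsto (fun s : ℝ => s * r) (𝓝[>] 0) (𝓝[>] 0) := by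
    have h : Tendsto (fun s : ℝ => s * r) (𝓝 0) (𝓝 0) := by
      simpa using (continuous_mul_const r).tendsto 0
    exact tendsto_nhdsWithin_iff.2 ⟨h.mono_left nhdsWithin_le_nhds,
      eventually_mem_nhdsWithin.mono fun s hs => mul_pos hs hr⟩
  have hball := IsUnifLocDoublingMeasure.tendsto_closedBall_filterAt (K := 1) μ
    (AffineMap.lineMap x w) _ hradius
    (eventually_mem_nhdsWithin.mono fun s hs => by
      simpa only [one_mul] using! mem_contractedBall hxw (mem_Ioi.1 hs).le)
  have hlim := hx.comp hball
  rw [indicator_of_notMem (notMem_compl_iff.2 hxE)] at hlim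
  filter_upwards [hlim.eventually (gt_mem_nhds hδ), self_mem_nhdsWithin] with s hs hs0
  rw [Function.comp_apply, ENNReal.div_lt_iff
    (.inl (Metric.measure_closedBall_pos μ _ (mul_pos hs0 hr)).ne')
    (.inl measure_closedBall_lt_top.ne)] at hs
  rwa [Set.sdiff_eq, inter_comm]

/-- The balls contained in `closedBall w r`, given by their centre and radius, of which `E` leaves
out exactly the proportion `δ`. -/
def ballsOfVacancy (μ : Measure V) (E : Set V) (δ : ℝ≥0∞) (w : V) (r : ℝ) : Set (V × ℝ) :=
  {q | 0 < q.2 ∧ q.2 ≤ r ∧ closedBall q.1 q.2 ⊆ closedBall w r ∧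
    μ (closedBall q.1 q.2 \ E) = δ * μ (closedBall q.1 q.2)}

/-- Contract the ball towards a density point `x` of `E`: the proportion left out by `E` decreases
continuously from at least `δ` to `0`. -/
lemma closedBall_inter_ae_le_biUnion_ballsOfVacancy (μ : Measure V) [μ.IsAddHaarMeasure] {E : Set V}
    (hE : MeasurableSet E) {δ : ℝ≥0} (hδ : 0 < δ) (hr : 0 < r)
    (h : δ * μ (closedBall w r) ≤ μ (closedBall w r \ E)) :
    (closedBall w r ∩ E : Set V) ≤ᵐ[μ]
      (⋃ q ∈ ballsOfVacancy μ E δ w r, closedBall q.1 q.2 : Set V) := by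
  filter_upwards [ae_eventually_measure_contractedBall_sdiff_lt μ hE (ENNReal.coe_pos.2 hδ) w hr]
    with x hx hxwE
  obtain ⟨hxw, hxE⟩ := hxwE
  have htop (s : ℝ) : μ (contractedBall x w r s) ≠ ∞ := measure_closedBall_lt_top.ne
  have htop' (s : ℝ) : μ (contractedBall x w r s \ E) ≠ ∞ :=
    measure_ne_top_of_subset sdiff_subset (htop s)
  have hmul_top (s : ℝ) : δ * μ (contractedBall x w r s) ≠ ∞ :=
    ENNReal.mul_ne_top ENNReal.coe_ne_top (htop s)
  obtain ⟨s₀, hlt, hs₀, hs₀1⟩ :=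
    ((hx hxw hxE).and (Ioo_mem_nhdsGT (zero_lt_one' ℝ))).exists
  let excess (s : ℝ) : ℝ :=
    μ.real (contractedBall x w r s \ E) - (δ * μ (contractedBall x w r s)).toReal
  have hcont : ContinuousOn excess (Ici 0) := by
    have hvol := continuousOn_measureReal_contractedBall (x := x) (w := w) (μ := μ) hr.le
    simp only [excess, ENNReal.toReal_mul]
    exact (continuousOn_measureReal_sdiff ((monotone_contractedBall hxw).monotoneOn _)
      (fun _ => measurableSet_closedBall) htop hvol E).sub (hvol.const_mul _)
  obtain ⟨s, ⟨hs₀s, hs1⟩, hs⟩ : (0 : ℝ) ∈ excess '' Icc s₀ 1 := by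
    refine intermediate_value_Icc hs₀1.le (hcont.mono fun s hs => hs₀.le.trans hs.1) ⟨?_, ?_⟩
    · exact sub_nonpos.2 (ENNReal.toReal_mono (hmul_top _) hlt.le)
    · refine sub_nonneg.2 (ENNReal.toReal_mono (htop' 1) ?_)
      rwa [contractedBall_one]
  have hs_pos : 0 < s := hs₀.trans_le hs₀s
  refine mem_biUnion (x := (AffineMap.lineMap x w s, s * r))
    ⟨mul_pos hs_pos hr, mul_le_of_le_one_left hr.le hs1, ?_, ?_⟩ (mem_contractedBall hxw hs_pos.le)
  · exact contractedBall_one x w r ▸ monotone_contractedBall hxw hs1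
  · exact (ENNReal.toReal_eq_toReal_iff' (htop' s) (hmul_top s)).1 (sub_eq_zero.1 hs)

lemma mul_measure_biUnion_closedBall_le (μ : Measure V) [μ.IsAddHaarMeasure] {E : Set V}
    (hE : MeasurableSet E) {δ : ℝ≥0∞} {t : Set (V × ℝ)} (ht_pos : ∀ q ∈ t, 0 < q.2)
    (ht_le : ∀ q ∈ t, q.2 ≤ r)
    (ht : ∀ q ∈ t, δ * μ (closedBall q.1 q.2) ≤ μ (closedBall q.1 q.2 \ E)) :
    δ * μ (⋃ q ∈ t, closedBall q.1 q.2) ≤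
      4 ^ finrank ℝ V * μ ((⋃ q ∈ t, closedBall q.1 q.2) \ E) := by
  obtain ⟨u, hut, hdisj, hsub⟩ := Vitali.exists_disjoint_subfamily_covering_enlargement_closedBall
    t Prod.fst Prod.snd r ht_le 4 (by norm_num)
  have hu : u.Countable := hdisj.countable_of_nonempty_interior fun q hq =>
    (Metric.nonempty_ball.2 (ht_pos q (hut hq))).mono Metric.ball_subset_interior_closedBall
  have hcover : ⋃ q ∈ t, closedBall q.1 q.2 ⊆ ⋃ q ∈ u, closedBall q.1 (4 * q.2) :=
    iUnion₂_subset fun q hq => by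
      obtain ⟨p, hp, hqp⟩ := hsub q hq
      exact hqp.trans (subset_biUnion_of_mem (u := fun p : V × ℝ => closedBall p.1 (4 * p.2)) hp)
  have henlarge (q : V × ℝ) :
      μ (closedBall q.1 (4 * q.2)) = 4 ^ finrank ℝ V * μ (closedBall q.1 q.2) := by
    rw [Measure.addHaar_closedBall_mul_of_pos μ _ four_pos, ← Measure.addHaar_closedBall_center μ
      q.1, ENNReal.ofReal_pow zero_le_four, ENNReal.ofReal_ofNat]
  calc δ * μ (⋃ q ∈ t, closedBall q.1 q.2)
      ≤ δ * ∑' q : u, μ (closedBall q.1.1 (4 * q.1.2)) := by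
        gcongr
        exact (measure_mono hcover).trans (measure_biUnion_le μ hu _)
    _ = 4 ^ finrank ℝ V * ∑' q : u, δ * μ (closedBall q.1.1 q.1.2) := by
        rw [ENNReal.tsum_mul_left, tsum_congr fun q : u => henlarge q.1,
          ENNReal.tsum_mul_left, mul_left_comm]
    _ ≤ 4 ^ finrank ℝ V * ∑' q : u, μ (closedBall q.1.1 q.1.2 \ E) := by
        gcongr with q
        exact ht q (hut q.2)
    _ = 4 ^ finrank ℝ V * μ (⋃ q ∈ u, closedBall q.1 q.2 \ E) := by
        rw [measure_biUnion hu (hdisj.mono_on fun q _ => sdiff_subset)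
          fun q _ => measurableSet_closedBall.diff hE]
    _ ≤ 4 ^ finrank ℝ V * μ ((⋃ q ∈ t, closedBall q.1 q.2) \ E) := by
        gcongr
        exact iUnion₂_subset fun q hq =>
          sdiff_subset_sdiff_left (subset_biUnion_of_mem (u := fun q : V × ℝ => closedBall q.1 q.2)
            (hut hq))

theorem mul_measure_closedBall_inter_le (μ : Measure V) [μ.IsAddHaarMeasure] {E E' : Set V}
    (hE : MeasurableSet E) {δ : ℝ≥0} (hδ : 0 < δ) (hr : 0 < r)
    (hE' : ∀ q ∈ ballsOfVacancy μ E δ w r, closedBall q.1 q.2 ⊆ E')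
    (h : δ * μ (closedBall w r) ≤ μ (closedBall w r \ E)) :
    ↑(1 + δ / 4 ^ finrank ℝ V) * μ (closedBall w r ∩ E) ≤ μ (closedBall w r ∩ E') := by
  set U := ⋃ q ∈ ballsOfVacancy μ E δ w r, closedBall q.1 q.2
  have hcover := closedBall_inter_ae_le_biUnion_ballsOfVacancy μ hE hδ hr h
  have hkeep : μ (closedBall w r ∩ E) ≤ μ (U ∩ E) :=
    measure_mono_ae (hcover.mono fun x hx hxE => ⟨hx hxE, hxE.2⟩)
  have hgain : ↑(δ / 4 ^ finrank ℝ V) * μ (closedBall w r ∩ E) ≤ μ (U \ E) := by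
    rw [ENNReal.coe_div (by positivity), ← ENNReal.mul_div_right_comm, ENNReal.coe_pow,
      ENNReal.coe_ofNat]
    refine ENNReal.div_le_of_le_mul' ((mul_le_mul_right (measure_mono_ae hcover) _).trans ?_)
    exact mul_measure_biUnion_closedBall_le μ hE (fun q hq => hq.1) (fun q hq => hq.2.1)
      fun q hq => hq.2.2.2.ge
  calc ↑(1 + δ / 4 ^ finrank ℝ V) * μ (closedBall w r ∩ E)
      = μ (closedBall w r ∩ E) + ↑(δ / 4 ^ finrank ℝ V) * μ (closedBall w r ∩ E) := by
        rw [ENNReal.coe_add, ENNReal.coe_one, add_mul, one_mul]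
    _ ≤ μ (U ∩ E) + μ (U \ E) := add_le_add hkeep hgain
    _ = μ U := measure_inter_add_sdiff U hE
    _ ≤ μ (closedBall w r ∩ E') :=
        measure_mono (iUnion₂_subset fun q hq => subset_inter hq.2.2.1 (hE' q hq))

lemma closedBall_subset_or_measure_lt_mul (μ : Measure V) [μ.IsAddHaarMeasure] {E E' : Set V}
    (hE : MeasurableSet E) {δ : ℝ≥0} (hδ : 0 < δ) (hr : 0 < r)
    (hE' : ∀ w r, 0 < r → μ (closedBall w r \ E) < δ * μ (closedBall w r) → closedBall w r ⊆ E')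
    {b : ℝ≥0∞} (h : μ (closedBall w r) <
      b * (↑(1 + δ / 2 / 4 ^ finrank ℝ V) * μ (closedBall w r ∩ E))) :
    closedBall w r ⊆ E' ∨ μ (closedBall w r) < b * μ (closedBall w r ∩ E') := by
  have hδ_half : δ / 2 < δ := NNReal.half_lt_self hδ.ne'
  rcases lt_or_ge (μ (closedBall w r \ E)) (δ * μ (closedBall w r)) with hlt | hge
  · exact .inl (hE' w r hr hlt)
  refine .inr (h.trans_le (mul_le_mul_right ?_ b))
  refine mul_measure_closedBall_inter_le μ hE (half_pos hδ) hr (fun q hq => ?_)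
    (le_trans (by gcongr) hge)
  refine hE' _ _ hq.1 (hq.2.2.2.trans_lt ?_)
  exact ENNReal.mul_lt_mul_left (Metric.measure_closedBall_pos μ _ hq.1).ne'
    measure_closedBall_lt_top.ne (ENNReal.coe_lt_coe.2 hδ_half)

end DensityGain

section Halo

variable {n : ℕ} {B : Set (Set (Fin n → ℝ))} {E F : Set (Fin n → ℝ)} {a : ℝ}

lemma haloSet_subset_haloSet {s t : ℝ} (hst : s ≤ t) (hEF : E ⊆ F) :
    haloSet B t E ⊆ haloSet B s F := fun _ (hx : _ < _) =>
  (ENNReal.ofReal_le_ofReal hst).trans_lt <| hx.trans_le <| iSup₂_mono fun _ _ =>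
    ENNReal.div_le_div_right (lintegral_mono fun _ => enorm_indicator_le_of_subset hEF _ _) _

lemma mem_haloSet_iff (hE : MeasurableSet E) {t : ℝ} {x : Fin n → ℝ} :
    x ∈ haloSet B t E ↔
      ∃ R ∈ B, x ∈ R ∧ ENNReal.ofReal t < volume (R ∩ E) / volume R := by
  have hint (R : Set (Fin n → ℝ)) :
      ∫⁻ y in R, ‖E.indicator (fun _ => (1 : ℝ)) y‖ₑ = volume (R ∩ E) := by
    simp only [enorm_indicator_eq_indicator_enorm, enorm_one]
    rw [lintegral_indicator_const hE, one_mul, Measure.restrict_apply hE, inter_comm]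
  simp only [haloSet, maximalFunction, mem_ofPred_eq, lt_iSup_iff, hint, exists_prop, and_assoc]

lemma haloFunction_of_le_one (ha : a ≤ 1) : haloFunction B a = ENNReal.ofReal a :=
  if_pos ha

lemma haloFunction_le (ha : 1 < a) {C : ℝ≥0∞}
    (h : ∀ E : Set (Fin n → ℝ), MeasurableSet E → volume E ≠ ∞ →
      volume (haloSet B (1 / a) E) ≤ C * volume E) :
    haloFunction B a ≤ C := by
  rw [haloFunction, if_neg ha.not_ge]
  refine iSup₂_le fun E hE => ENNReal.div_le_of_le_mul ?_
  rw [← measure_toMeasurable E]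
  exact (measure_mono (haloSet_subset_haloSet le_rfl (subset_toMeasurable _ _))).trans
    (h _ (measurableSet_toMeasurable _ _) (by rw [measure_toMeasurable]; exact hE.2.2.ne))

lemma volume_haloSet_le (ha : 1 < a) (hE : MeasurableSet E) (htop : volume E ≠ ∞) :
    volume (haloSet B (1 / a) E) ≤ haloFunction B a * volume E := by
  rcases eq_or_ne (volume E) 0 with h0 | h0
  · have hempty : haloSet B (1 / a) E = ∅ := eq_empty_of_forall_notMem fun x hx => by
      obtain ⟨R, -, -, hR⟩ := (mem_haloSet_iff hE).1 hx
      rw [measure_mono_null inter_subset_right h0, ENNReal.zero_div] at hR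
      exact not_lt_zero hR
    rw [hempty, measure_empty]
    exact zero_le
  · rw [← ENNReal.div_le_iff h0 htop, haloFunction, if_neg ha.not_ge]
    exact le_iSup₂_of_le E ⟨hE.nullMeasurableSet, pos_iff_ne_zero.2 h0, htop.lt_top⟩ le_rfl

lemma mem_cubes_iff {R : Set (Fin n → ℝ)} : R ∈ cubes n ↔ ∃ w r, 0 < r ∧ R = ball w r := by
  constructor
  · rintro ⟨a, l, hl, rfl⟩
    refine ⟨fun i => a i + l / 2, l / 2, half_pos hl, ?_⟩
    simp only [ball_pi _ (half_pos hl), Real.ball_eq_Ioo, add_sub_cancel_right, add_assoc,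
      add_halves]
  · rintro ⟨w, r, hr, rfl⟩
    refine ⟨fun i => w i - r, 2 * r, by positivity, ?_⟩
    simp only [ball_pi _ hr, Real.ball_eq_Ioo, two_mul, sub_add_add_cancel]

lemma closedBall_mem_closedBoxes (w : Fin n → ℝ) {r : ℝ} (hr : 0 ≤ r) :
    closedBall w r ∈ closedBoxes (Fin n → ℝ) := by
  refine ⟨fun i => w i - r, fun i => w i + r, ?_⟩
  simp only [closedBall_pi w hr, Real.closedBall_eq_Icc, pi_univ_Icc]

lemma ball_ae_eq_closedBall {V : Type*} [NormedAddCommGroup V] [NormedSpace ℝ V]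
    [FiniteDimensional ℝ V] [MeasurableSpace V] [BorelSpace V] (μ : Measure V) [μ.IsAddHaarMeasure]
    (w : V) {r : ℝ} (hr : r ≠ 0) : (ball w r : Set V) =ᵐ[μ] closedBall w r := by
  rw [← Metric.closedBall_sdiff_sphere]
  exact sdiff_null_ae_eq_self (Measure.addHaar_sphere_of_ne_zero μ w hr)

lemma mem_haloSet_cubes_iff (hE : MeasurableSet E) (ha : 0 < a) {x : Fin n → ℝ} :
    x ∈ haloSet (cubes n) (1 / a) E ↔ ∃ w r, 0 < r ∧ x ∈ ball w r ∧
      volume (closedBall w r) < ENNReal.ofReal a * volume (closedBall w r ∩ E) := by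
  have havg (w : Fin n → ℝ) {r : ℝ} (hr : 0 < r) :
      ENNReal.ofReal (1 / a) < volume (ball w r ∩ E) / volume (ball w r) ↔
        volume (closedBall w r) < ENNReal.ofReal a * volume (closedBall w r ∩ E) := by
    have hball := ball_ae_eq_closedBall volume w hr.ne'
    rw [measure_congr hball, measure_congr (hball.inter (ae_eq_refl E)),
      ENNReal.lt_div_iff_mul_lt (.inl (Metric.measure_closedBall_pos _ _ hr).ne')
        (.inl measure_closedBall_lt_top.ne), one_div, ENNReal.ofReal_inv_of_pos ha, mul_comm,
      ← div_eq_mul_inv, ENNReal.div_lt_iff (.inl (by simpa)) (.inl ENNReal.ofReal_ne_top), mul_comm]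
  simp only [mem_haloSet_iff hE, mem_cubes_iff]
  constructor
  · rintro ⟨_, ⟨w, r, hr, rfl⟩, hx, h⟩
    exact ⟨w, r, hr, hx, (havg w hr).1 h⟩
  · rintro ⟨w, r, hr, hx, h⟩
    exact ⟨_, ⟨w, r, hr, rfl⟩, hx, (havg w hr).2 h⟩

lemma volume_closedBall_lt_ofReal_mul (ha : 1 < a) (w : Fin n → ℝ) {r : ℝ} (hr : 0 < r) :
    volume (closedBall w r) < ENNReal.ofReal a * volume (closedBall w r) := by
  conv_lhs => rw [← one_mul (volume _)]
  exact ENNReal.mul_lt_mul_left (Metric.measure_closedBall_pos _ _ hr).ne'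
    measure_closedBall_lt_top.ne (ENNReal.one_lt_ofReal.2 ha)

lemma one_le_haloFunction_cubes (ha : 1 < a) : 1 ≤ haloFunction (cubes n) a := by
  set Q := ball (0 : Fin n → ℝ) 1
  have hQ : volume (closedBall (0 : Fin n → ℝ) 1) = volume Q :=
    (measure_congr (ball_ae_eq_closedBall volume 0 one_ne_zero)).symm
  have hsub : Q ⊆ haloSet (cubes n) (1 / a) Q := fun x hx => by
    refine (mem_haloSet_cubes_iff measurableSet_ball (by positivity)).2 ⟨0, 1, one_pos, hx, ?_⟩
    rw [inter_eq_right.2 Metric.ball_subset_closedBall, ← hQ]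
    exact volume_closedBall_lt_ofReal_mul ha 0 one_pos
  refine (ENNReal.mul_le_mul_iff_left (Metric.measure_ball_pos volume _ one_pos).ne'
    measure_ball_lt_top.ne).1 (?_ : 1 * volume Q ≤ _ * volume Q)
  rw [one_mul]
  exact (measure_mono hsub).trans (volume_haloSet_le ha measurableSet_ball measure_ball_lt_top.ne)

lemma monotone_haloFunction_cubes (n : ℕ) : Monotone (haloFunction (cubes n)) := by
  intro a b hab
  rcases le_or_gt b 1 with hb | hb
  · rw [haloFunction_of_le_one hb, haloFunction_of_le_one (hab.trans hb)]
    exact ENNReal.ofReal_le_ofReal hab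
  rcases le_or_gt a 1 with ha | ha
  · rw [haloFunction_of_le_one ha]
    exact (ENNReal.ofReal_le_one.2 ha).trans (one_le_haloFunction_cubes hb)
  refine haloFunction_le ha fun E hE htop => le_trans (measure_mono ?_)
    (volume_haloSet_le hb hE htop)
  exact haloSet_subset_haloSet (one_div_le_one_div_of_le (by positivity) hab) subset_rfl

theorem haloFunction_cubes_dilation_le {s : ℝ≥0} (hs0 : 0 < s) (hs1 : s ≤ 1) (ha : 1 ≤ a) :
    haloFunction (cubes n) ((1 + (s / 16) ^ n / 2) * a) ≤
      (1 + s) ^ n * haloFunction (cubes n) a := by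
  set κ : ℝ := 1 + (s / 16) ^ n / 2 with hκ
  have hκ1 : 1 < κ := lt_add_of_pos_right _ (by positivity)
  have hκa : 1 < κ * a := one_lt_mul_of_lt_of_le hκ1 ha
  refine haloFunction_le hκa fun E hE htop => ?_
  obtain ⟨E', hE', hvol, hsub⟩ := (FiberwiseSolyanik.volume_pi hs1 n).exists_superset hE
  have hdichotomy {x : Fin n → ℝ} (hx : x ∈ haloSet (cubes n) (1 / (κ * a)) E) :
      ∃ w r, 0 < r ∧ x ∈ ball w r ∧ (closedBall w r ⊆ E' ∨
        volume (closedBall w r) < ENNReal.ofReal a * volume (closedBall w r ∩ E')) := by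
    obtain ⟨w, r, hr, hxw, h⟩ := (mem_haloSet_cubes_iff hE (by positivity)).1 hx
    refine ⟨w, r, hr, hxw, closedBall_subset_or_measure_lt_mul volume hE (δ := (s / 4) ^ n)
      (by positivity) hr (fun w r hr hlt => hsub _ (closedBall_mem_closedBoxes w hr.le) ?_) ?_⟩
    · exact_mod_cast hlt
    · have hκ' : ((1 + (s / 4) ^ n / 2 / 4 ^ n : ℝ≥0) : ℝ) = κ := by
        rw [hκ]
        push_cast
        rw [div_right_comm, ← div_pow, div_div]
        norm_num
      rwa [Module.finrank_fin_fun, ← ENNReal.ofReal_coe_nnreal, hκ', ← mul_assoc,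
        ← ENNReal.ofReal_mul (by positivity), mul_comm a]
  rcases ha.eq_or_lt with rfl | ha
  · rw [haloFunction_of_le_one le_rfl, ENNReal.ofReal_one, mul_one (_ ^ n)]
    refine (measure_mono fun x hx => ?_).trans hvol
    obtain ⟨w, r, -, hxw, hfull | hlt⟩ := hdichotomy hx
    · exact hfull (Metric.ball_subset_closedBall hxw)
    · rw [ENNReal.ofReal_one, one_mul] at hlt
      exact absurd hlt (measure_mono inter_subset_left).not_gt
  · calc volume (haloSet (cubes n) (1 / (κ * a)) E)
        ≤ volume (haloSet (cubes n) (1 / a) E') := measure_mono fun x hx => by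
          obtain ⟨w, r, hr, hxw, h⟩ := hdichotomy hx
          refine (mem_haloSet_cubes_iff hE' (by positivity)).2 ⟨w, r, hr, hxw, h.elim ?_ id⟩
          intro hfull
          rw [inter_eq_left.2 hfull]
          exact volume_closedBall_lt_ofReal_mul ha w hr
      _ ≤ haloFunction (cubes n) a * volume E' :=
          volume_haloSet_le ha hE' (ne_top_of_le_ne_top (by finiteness) hvol)
      _ ≤ haloFunction (cubes n) a * ((1 + s) ^ n * volume E) := by gcongr
      _ = (1 + s) ^ n * haloFunction (cubes n) a * volume E := by ring

theorem haloFunction_cubes_ne_top (n : ℕ) (a : ℝ) : haloFunction (cubes n) a ≠ ∞ := by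
  set κ : ℝ := 1 + ((1 : ℝ≥0) / 16) ^ n / 2
  have hκ : 1 < κ := lt_add_of_pos_right _ (by positivity)
  have hpow (k : ℕ) : haloFunction (cubes n) (κ ^ k) ≠ ∞ := by
    induction k with
    | zero => simp [haloFunction_of_le_one]
    | succ k ih =>
      rw [pow_succ']
      exact ne_top_of_le_ne_top (by finiteness)
        (haloFunction_cubes_dilation_le one_pos le_rfl (one_le_pow₀ hκ.le))
  obtain ⟨k, hk⟩ := pow_unbounded_of_one_lt a hκ
  exact ne_top_of_le_ne_top (hpow k) (monotone_haloFunction_cubes n hk.le)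

end Halo

section Holder

variable {f : ℝ → ℝ} {n : ℕ}

lemma one_add_pow_le_one_add_two_pow_mul {u : ℝ} (hu0 : 0 ≤ u) (hu1 : u ≤ 1) (n : ℕ) :
    (1 + u) ^ n ≤ 1 + 2 ^ n * u := by
  have hconv : ((1 - u) * 1 + u * 2) ^ n ≤ (1 - u) * 1 ^ n + u * 2 ^ n :=
    (convexOn_pow n).2 (mem_Ici.2 zero_le_one) (mem_Ici.2 zero_le_two) (sub_nonneg.2 hu1) hu0
      (sub_add_cancel 1 u)
  calc (1 + u) ^ n = ((1 - u) * 1 + u * 2) ^ n := by ring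
    _ ≤ (1 - u) * 1 ^ n + u * 2 ^ n := hconv
    _ ≤ 1 + 2 ^ n * u := by rw [one_pow]; linarith

/-- Apply the dilation inequality with the `s` for which `c * s ^ n = y - x`; then
`y ≤ (1 + c * s ^ n) * x` because `1 ≤ x`. -/
lemma sub_le_mul_rpow_of_dilation {c M x y A : ℝ} (hf : Monotone f) (hf1 : 0 ≤ f 1) (hn : n ≠ 0)
    (hc : 0 < c) (hM : 1 ≤ M)
    (hdil : ∀ s, 0 < s → s ≤ 1 → ∀ x, 1 ≤ x → f ((1 + c * s ^ n) * x) ≤ (1 + M * s) * f x)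
    (hx : 1 ≤ x) (hxy : x ≤ y) (hyA : y ≤ A) :
    f y - f x ≤ M * f A * ((y - x) / c) ^ (1 / n : ℝ) := by
  have hfx : 0 ≤ f x := hf1.trans (hf hx)
  have hfA : f x ≤ f A := hf (hxy.trans hyA)
  have hyx : 0 ≤ (y - x) / c := div_nonneg (sub_nonneg.2 hxy) hc.le
  set s := ((y - x) / c) ^ (1 / n : ℝ) with hs
  rcases hxy.eq_or_lt with rfl | hlt
  · rw [sub_self]
    have hs0 : 0 ≤ s := Real.rpow_nonneg hyx _
    exact mul_nonneg (mul_nonneg (by positivity) (hfx.trans hfA)) hs0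
  have hs0 : 0 < s := Real.rpow_pos_of_pos (div_pos (sub_pos.2 hlt) hc) _
  rcases le_or_gt s 1 with hs1 | hs1
  · have hsn : c * s ^ n = y - x := by
      rw [hs, one_div, Real.rpow_inv_natCast_pow hyx hn, mul_div_cancel₀ _ hc.ne']
    have hy : y ≤ (1 + c * s ^ n) * x := by
      rw [hsn]
      nlinarith
    calc f y - f x ≤ (1 + M * s) * f x - f x := by gcongr; exact (hf hy).trans (hdil s hs0 hs1 x hx)
      _ = M * f x * s := by ring
      _ ≤ M * f A * s := by gcongr
  · calc f y - f x ≤ f A := by linarith [hf hyA]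
      _ ≤ M * f A := le_mul_of_one_le_left (hfx.trans hfA) hM
      _ ≤ M * f A * s := le_mul_of_one_le_right (mul_nonneg (by positivity) (hfx.trans hfA)) hs1.le

lemma sub_le_add_one_mul_rpow {p C A x y : ℝ} (hp0 : 0 ≤ p) (hp1 : p ≤ 1) (hC : 0 ≤ C)
    (hid : ∀ a ∈ Icc (0 : ℝ) 1, f a = a)
    (h : ∀ x y, 1 ≤ x → x ≤ y → y ≤ A → f y - f x ≤ C * (y - x) ^ p)
    (hA : 1 ≤ A) (hx : 0 ≤ x) (hxy : x ≤ y) (hyA : y ≤ A) :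
    f y - f x ≤ (C + 1) * (y - x) ^ p := by
  have hsplit {a : ℝ} (ha : 0 ≤ a) : f a = f (max a 1) + (min a 1 - 1) := by
    rcases le_total a 1 with ha1 | ha1
    · rw [max_eq_right ha1, min_eq_left ha1, hid a ⟨ha, ha1⟩, hid 1 ⟨zero_le_one, le_rfl⟩]
      ring
    · rw [max_eq_left ha1, min_eq_right ha1, sub_self, add_zero]
  have hmax : f (max y 1) - f (max x 1) ≤ C * (y - x) ^ p := by
    have hle : max x 1 ≤ max y 1 := max_le_max_right 1 hxy
    have hdiff : max y 1 - max x 1 ≤ y - x := sub_le_iff_le_add.2 <|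
      max_le (by linarith [le_max_left x 1]) (by linarith [le_max_right x 1])
    refine (h _ _ (le_max_right _ _) hle (max_le hyA hA)).trans ?_
    gcongr
  have hmin : min y 1 - min x 1 ≤ (y - x) ^ p := by
    have hle : 0 ≤ min y 1 - min x 1 := sub_nonneg.2 (min_le_min_right 1 hxy)
    have hdiff : min y 1 - min x 1 ≤ y - x := sub_le_comm.1 <|
      le_min (by linarith [min_le_left y 1]) (by linarith [min_le_right y 1])
    have hle1 : min y 1 - min x 1 ≤ 1 := by
      linarith [min_le_right y 1, le_min hx zero_le_one]
    exact (Real.self_le_rpow_of_le_one hle hle1 hp1).trans (by gcongr)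
  rw [hsplit hx, hsplit (hx.trans hxy)]
  linarith

lemma holderOnWith_of_monotoneOn_of_sub_le {C p : ℝ≥0} {K : Set ℝ} (hf : MonotoneOn f K)
    (h : ∀ x ∈ K, ∀ y ∈ K, x ≤ y → f y - f x ≤ C * (y - x) ^ (p : ℝ)) : HolderOnWith C p f K := by
  intro x hx y hy
  wlog hxy : x ≤ y generalizing x y
  · rw [edist_comm, edist_comm x]
    exact this y hy x hx (le_of_not_ge hxy)
  have hyx : 0 ≤ y - x := sub_nonneg.2 hxy
  rw [edist_comm, edist_comm x, edist_dist, edist_dist, Real.dist_eq, Real.dist_eq,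
    abs_of_nonneg (sub_nonneg.2 (hf hx hy hxy)), abs_of_nonneg hyx,
    ENNReal.ofReal_rpow_of_nonneg hyx p.coe_nonneg, ← ENNReal.ofReal_coe_nnreal (p := C),
    ← ENNReal.ofReal_mul C.coe_nonneg]
  exact ENNReal.ofReal_le_ofReal (h x hx y hy hxy)

theorem holderClass_of_dilation {c M : ℝ} (hf : Monotone f) (hid : ∀ a ∈ Icc (0 : ℝ) 1, f a = a)
    (hn : n ≠ 0) (hc : 0 < c) (hM : 1 ≤ M)
    (hdil : ∀ s, 0 < s → s ≤ 1 → ∀ x, 1 ≤ x → f ((1 + c * s ^ n) * x) ≤ (1 + M * s) * f x) :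
    HolderClass (1 / n) (Ici 0) f := by
  intro K hK hK0
  obtain ⟨b, hb⟩ := hK.bddAbove
  set A := max b 1
  have hA : 1 ≤ A := le_max_right b 1
  have hf1 : 0 ≤ f 1 := zero_le_one.trans_eq (hid 1 ⟨zero_le_one, le_rfl⟩).symm
  let C : ℝ≥0 := ⟨M * f A / c ^ (1 / n : ℝ),
    div_nonneg (mul_nonneg (by positivity) (hf1.trans (hf hA))) (by positivity)⟩
  have hC : ∀ x y, 1 ≤ x → x ≤ y → y ≤ A → f y - f x ≤ C * (y - x) ^ (1 / n : ℝ) := by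
    intro x y hx hxy hyA
    refine (sub_le_mul_rpow_of_dilation hf hf1 hn hc hM hdil hx hxy hyA).trans_eq ?_
    rw [Real.div_rpow (sub_nonneg.2 hxy) hc.le, mul_div_left_comm, mul_comm]
    rfl
  have hn1 : (1 / n : ℝ) ≤ 1 := by
    rw [one_div]
    exact Nat.cast_inv_le_one n
  refine ⟨C + 1, holderOnWith_of_monotoneOn_of_sub_le (hf.monotoneOn K) fun x hx y hy hxy => ?_⟩
  push_cast
  exact sub_le_add_one_mul_rpow (by positivity) hn1 C.2 hid hC hA (hK0 hx) hxy
    ((hb hy).trans (le_max_left b 1))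

end Holder

lemma toReal_haloFunction_cubes_dilation_le {n : ℕ} {s a : ℝ} (hs0 : 0 < s) (hs1 : s ≤ 1)
    (ha : 1 ≤ a) :
    (haloFunction (cubes n) ((1 + (1 / 16) ^ n / 2 * s ^ n) * a)).toReal ≤
      (1 + 2 ^ n * s) * (haloFunction (cubes n) a).toReal := by
  lift s to ℝ≥0 using hs0.le
  have htop : (1 + (s : ℝ≥0∞)) ^ n * haloFunction (cubes n) a ≠ ∞ :=
    ENNReal.mul_ne_top (by finiteness) (haloFunction_cubes_ne_top n a)
  have hscale : (1 / 16 : ℝ) ^ n / 2 * s ^ n = (s / 16) ^ n / 2 := by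
    rw [div_mul_eq_mul_div, ← mul_pow, one_div_mul_eq_div]
  calc (haloFunction (cubes n) ((1 + (1 / 16) ^ n / 2 * s ^ n) * a)).toReal
      ≤ ((1 + (s : ℝ≥0∞)) ^ n * haloFunction (cubes n) a).toReal := by
        rw [hscale]
        exact ENNReal.toReal_mono htop (haloFunction_cubes_dilation_le hs0 hs1 ha)
    _ = (1 + s) ^ n * (haloFunction (cubes n) a).toReal := by
        rw [ENNReal.toReal_mul, ENNReal.toReal_pow,
          ENNReal.toReal_add (by finiteness) (by finiteness), ENNReal.toReal_one,
          ENNReal.coe_toReal]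
    _ ≤ (1 + 2 ^ n * s) * (haloFunction (cubes n) a).toReal := by
        gcongr
        exact one_add_pow_le_one_add_two_pow_mul s.2 hs1 n

end GeomMax

theorem corollaryc4 (n : ℕ) (hn : 1 ≤ n) :
    (∀ a : ℝ, 0 ≤ a → GeomMax.haloFunction (GeomMax.cubes n) a ≠ ∞) ∧
      GeomMax.HolderClass (1 / (n : ℝ≥0)) (Set.Ici 0)
        (fun a => (GeomMax.haloFunction (GeomMax.cubes n) a).toReal) := by
  refine ⟨fun a _ => GeomMax.haloFunction_cubes_ne_top n a, ?_⟩
  refine GeomMax.holderClass_of_dilation (c := (1 / 16) ^ n / 2) (M := 2 ^ n) (fun a b hab => ?_)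
    (fun a ha => ?_) (Nat.one_le_iff_ne_zero.1 hn) (by positivity) (one_le_pow₀ one_le_two)
    fun s hs0 hs1 x hx => GeomMax.toReal_haloFunction_cubes_dilation_le hs0 hs1 hx
  · exact ENNReal.toReal_mono (GeomMax.haloFunction_cubes_ne_top n b)
      (GeomMax.monotone_haloFunction_cubes n hab)
  · rw [GeomMax.haloFunction_of_le_one ha.2, ENNReal.toReal_ofReal ha.1]
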